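/- Let $n\ge 1$, let $D^n=\{z\in\mathbb C^n : |z_i|<1 \text{ for all } i\}$ be the open unit polydisc, let $\partial D^n$ be its topological boundary, and let $C(\partial D^n)$ be the Banach space of continuous functions $\partial D^n\to\mathbb C$ with the supremum norm. A function $f:\partial D^n\to\mathbb C$ is \emph{holomorphically extendable from one side} at $\zeta\in\partial D^n$ (in the usual sense) if there are an open neighborhood $U\subseteq\mathbb C^n$ of $\zeta$ and a continuous function $F:[U\cap D^n]\cup\partial D^n\to\mathbb C$ that is holomorphic on $U\cap D^n$ and agrees with $f$ on $\partial D^n$. It is so extendable \emph{in the separately continuous sense} if, instead of being continuous, $F$ is only required to be bounded and separately continuous in its variables on $[U\cap D^n]\cup\partial D^n$ (for each $i$ and each fixed choice of the other coordinates, $F$ is continuous in the $i$-th coordinate on the corresponding slice of this set), and \emph{in the Lipschitz sense} if $F$ is required to be Lipschitz continuous on $[U\cap D^n]\cup\partial D^n$. Then: 1. The set of functions in $C(\partial D^n)$ that are at no point of $\partial D^n$ holomorphically extendable from one side in the separately continuous sense is a dense $G_\delta$ subset of $C(\partial D^n)$. 2. The set of functions in $C(\partial D^n)$ that are at no point of $\partial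 D^n$ holomorphically extendable from one side in the usual sense is residual in $C(\partial D^n)$, i.e. it contains a dense $G_\delta$ subset of $C(\partial D^n)$. 3. The set of functions in $C(\partial D^n)$ that are at no point of $\partial D^n$ holomorphically extendable from one side in the Lipschitz sense is a dense $G_\delta$ subset of $C(\partial D^n)$. -/

import Mathlib

/-- The open unit polydisc `Dⁿ` in `ℂⁿ`. -/
def polydisc (n : ℕ) : Set (Fin n → ℂ) := {z | ∀ i, ‖z i‖ < 1}

/-- The (full topological) boundary `∂Dⁿ` of the polydisc. -/
abbrev polydiscBoundary (n : ℕ) : Set (Fin n → ℂ) := frontier (polydisc n)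

/-- The set `[U ∩ Dⁿ] ∪ ∂Dⁿ` on which a one-sided extension lives. -/
def oneSidedDomain {n : ℕ} (U : Set (Fin n → ℂ)) : Set (Fin n → ℂ) :=
  (U ∩ polydisc n) ∪ polydiscBoundary n

/-- `F` is separately continuous on `S`: for every index `i` and every choice of the other
coordinates, it is continuous as a function of the `i`-th coordinate on the slice of `S`. -/
def SeparatelyContinuousOn {n : ℕ} (F : (Fin n → ℂ) → ℂ) (S : Set (Fin n → ℂ)) : Prop :=
  ∀ (z : Fin n → ℂ) (i : Fin n),
    ContinuousOn (fun w : ℂ => F (Function.update z i w)) {w : ℂ | Function.update z i w ∈ S}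

/-- `F` is holomorphic on `U ∩ Dⁿ` and agrees with `f` on `∂Dⁿ`.  Only the values of `F` on
`oneSidedDomain U` matter. -/
def IsOneSidedExtension {n : ℕ} (f : polydiscBoundary n → ℂ) (U : Set (Fin n → ℂ))
    (F : (Fin n → ℂ) → ℂ) : Prop :=
  DifferentiableOn ℂ F (U ∩ polydisc n) ∧ ∀ z : polydiscBoundary n, F z = f z

/-- `f` is holomorphically extendable from one side at `ζ`, in the usual sense. -/
def OneSidedExtendableAt {n : ℕ} (f : polydiscBoundary n → ℂ) (ζ : polydiscBoundary n) : Prop :=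
  ∃ U : Set (Fin n → ℂ), IsOpen U ∧ (ζ : Fin n → ℂ) ∈ U ∧
    ∃ F : (Fin n → ℂ) → ℂ, IsOneSidedExtension f U F ∧ ContinuousOn F (oneSidedDomain U)

/-- `f` is holomorphically extendable from one side at `ζ`, in the separately continuous sense:
the extension is bounded and separately continuous. -/
def SepContOneSidedExtendableAt {n : ℕ} (f : polydiscBoundary n → ℂ)
    (ζ : polydiscBoundary n) : Prop :=
  ∃ U : Set (Fin n → ℂ), IsOpen U ∧ (ζ : Fin n → ℂ) ∈ U ∧
    ∃ F : (Fin n → ℂ) → ℂ, IsOneSidedExtension f U F ∧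
      (∃ M : ℝ, ∀ z ∈ oneSidedDomain U, ‖F z‖ ≤ M) ∧
      SeparatelyContinuousOn F (oneSidedDomain U)

/-- `f` is holomorphically extendable from one side at `ζ`, in the Lipschitz sense.  (Since the
Lipschitz constant is existentially quantified, the choice of norm on `ℂⁿ` is immaterial.) -/
def LipschitzOneSidedExtendableAt {n : ℕ} (f : polydiscBoundary n → ℂ)
    (ζ : polydiscBoundary n) : Prop :=
  ∃ U : Set (Fin n → ℂ), IsOpen U ∧ (ζ : Fin n → ℂ) ∈ U ∧
    ∃ F : (Fin n → ℂ) → ℂ, IsOneSidedExtension f U F ∧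
      ∃ K : NNReal, LipschitzOnWith K F (oneSidedDomain U)

/-- The functions in `C(∂Dⁿ)` that are extendable at no point of `∂Dⁿ` (usual sense). -/
def nowhereOneSidedExtendable (n : ℕ) : Set C(polydiscBoundary n, ℂ) :=
  {f | ∀ ζ : polydiscBoundary n, ¬ OneSidedExtendableAt f ζ}

/-- The functions in `C(∂Dⁿ)` that are extendable at no point of `∂Dⁿ` (separately continuous
sense). -/
def nowhereSepContOneSidedExtendable (n : ℕ) : Set C(polydiscBoundary n, ℂ) :=
  {f | ∀ ζ : polydiscBoundary n, ¬ SepContOneSidedExtendableAt f ζ}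

/-- The functions in `C(∂Dⁿ)` that are extendable at no point of `∂Dⁿ` (Lipschitz sense). -/
def nowhereLipschitzOneSidedExtendable (n : ℕ) : Set C(polydiscBoundary n, ℂ) :=
  {f | ∀ ζ : polydiscBoundary n, ¬ LipschitzOneSidedExtendableAt f ζ}

/-! The argument is Baire category. For a boundary point `c`, a radius and an integer bound,
consider the functions with an extension to that ball having that bound. Only countably many such
sets are needed: centres in a countable dense set, radii `1 / (m + 1)`, integer bounds.

Two facts suffice. First, the closure of each set still consists of functions extendable at `c`, on
a smaller ball (`exists_limit_extension`). On a one-variable slice through a coordinate with `‖c i‖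
= 1`, part of the slice's boundary lies in `∂Dⁿ`; a two-constants estimate then shows that uniformly
bounded extensions with uniformly convergent boundary values converge uniformly near `c`. Hence the
extendable functions form a countable union of closed sets. Second, the functions extendable at `c`
form a proper linear subspace, which has empty interior.

Usual and Lipschitz extendability both imply the separately continuous one. This gives the residual
set of the usual case, and empty interior for the Lipschitz closed sets. -/

open Set Filter Topology Metric

/-! ### One variable: boundary estimates and uniqueness near an arc of the circle -/

section OneVariable

/-- Maximum principle for `g` times `exp (N (conj a * w - 1))`. This weight has modulus at most 1 on
the closed disc and at most `exp (-N r² / 2)` at distance at least `r` from `a`; within `r² / 4` of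
`a`, dividing by it costs at most `exp (N r² / 4)`. -/
theorem two_constants_near_arc {g : ℂ → ℂ} {a : ℂ} {r M ε N : ℝ} (hN : 0 ≤ N) (ha : ‖a‖ = 1)
    (hr : 0 < r) (hr1 : r ≤ 1) (hd : DifferentiableOn ℂ g (ball 0 1 ∩ ball a r))
    (hc : ContinuousOn g (closedBall 0 1 ∩ closedBall a r))
    (hM : ∀ w ∈ closedBall (0 : ℂ) 1 ∩ closedBall a r, ‖g w‖ ≤ M)
    (hε : ∀ w ∈ sphere (0 : ℂ) 1 ∩ closedBall a r, ‖g w‖ ≤ ε)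
    {w : ℂ} (hw : ‖w‖ ≤ 1) (hwa : dist w a ≤ r ^ 2 / 4) :
    ‖g w‖ ≤ Real.exp (N * (r ^ 2 / 4)) * max ε (M * Real.exp (-(N * (r ^ 2 / 2)))) := by
  set V : Set ℂ := ball 0 1 ∩ ball a r
  have hVo : IsOpen V := isOpen_ball.inter isOpen_ball
  have hVcl : closure V ⊆ closedBall 0 1 ∩ closedBall a r :=
    closure_minimal (inter_subset_inter ball_subset_closedBall ball_subset_closedBall)
      (isClosed_closedBall.inter isClosed_closedBall)
  have ha2 : a.re * a.re + a.im * a.im = 1 := by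
    rw [← Complex.normSq_apply, ← Complex.sq_norm, ha, one_pow]
  have hexp : ∀ z : ℂ, ‖Complex.exp (N * ((starRingEnd ℂ) a * z - 1))‖ =
      Real.exp (N * (a.re * z.re + a.im * z.im - 1)) := by
    intro z; rw [Complex.norm_exp]; simp
  have hdist : ∀ z : ℂ, dist z a ^ 2 = ‖z‖ ^ 2 + 1 - 2 * (a.re * z.re + a.im * z.im) := by
    intro z
    rw [dist_eq_norm, Complex.sq_norm, Complex.sq_norm, Complex.normSq_apply, Complex.normSq_apply]
    simp only [Complex.sub_re, Complex.sub_im]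
    linarith
  -- Polarization: `2 (Re (conj a * z) - 1) = ‖z‖² - 1 - |z - a|²`.
  have hre : ∀ z : ℂ, ‖z‖ ≤ 1 → a.re * z.re + a.im * z.im - 1 ≤ -(dist z a ^ 2 / 2) := by
    intro z hz
    have := hdist z
    have : ‖z‖ ^ 2 ≤ 1 := pow_le_one₀ (norm_nonneg _) hz
    linarith
  have hε0 : 0 ≤ ε := (norm_nonneg _).trans (hε a ⟨by simp [ha], by simp [hr.le]⟩)
  have hM0 : 0 ≤ M := (norm_nonneg _).trans (hM a ⟨by simp [ha], by simp [hr.le]⟩)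
  rcases hw.lt_or_eq with hw1 | hw1
  swap
  · refine (hε w ⟨by simp [hw1], by simp only [mem_closedBall]; nlinarith⟩).trans ?_
    refine (le_max_left ε (M * Real.exp (-(N * (r ^ 2 / 2))))).trans ?_
    exact le_mul_of_one_le_left (hε0.trans (le_max_left _ _)) (Real.one_le_exp (by positivity))
  have hwV : w ∈ V := ⟨by simpa using hw1, by simp only [mem_ball]; nlinarith⟩
  have key : ‖Complex.exp (N * ((starRingEnd ℂ) a * w - 1)) * g w‖ ≤
      max ε (M * Real.exp (-(N * (r ^ 2 / 2)))) := by
    refine Complex.norm_le_of_forall_mem_frontier_norm_le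
      (f := fun w => Complex.exp (N * ((starRingEnd ℂ) a * w - 1)) * g w) (U := V)
      (isBounded_ball.subset inter_subset_left) ⟨?_, ?_⟩ ?_ (subset_closure hwV)
    · exact DifferentiableOn.mul (by fun_prop) hd
    · exact ContinuousOn.mul (by fun_prop) (hc.mono hVcl)
    · intro z hz
      have hzc := hVcl hz.1
      have hz1 : ‖z‖ ≤ 1 := by simpa using hzc.1
      have hznot : z ∉ V := by rw [hVo.frontier_eq] at hz; exact hz.2
      rw [norm_mul, hexp]
      by_cases hz2 : ‖z‖ = 1
      · refine le_max_of_le_left ?_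
        refine (mul_le_of_le_one_left (norm_nonneg _) (Real.exp_le_one_iff.2 ?_)).trans
          (hε z ⟨by simp [hz2], hzc.2⟩)
        exact mul_nonpos_of_nonneg_of_nonpos hN ((hre z hz1).trans (by nlinarith [sq_nonneg (dist z a)]))
      · refine le_max_of_le_right ?_
        have hza : r ≤ dist z a := by
          by_contra! h
          exact hznot ⟨by simpa using lt_of_le_of_ne hz1 hz2, h⟩
        rw [mul_comm]
        refine mul_le_mul (hM z hzc) (Real.exp_le_exp.2 ?_) (Real.exp_pos _).le hM0
        have h1 := hre z hz1
        have h2 : r ^ 2 ≤ dist z a ^ 2 := pow_le_pow_left₀ hr.le hza 2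
        nlinarith
  rw [norm_mul, hexp] at key
  have h1 : 1 - (a.re * w.re + a.im * w.im) ≤ r ^ 2 / 4 := by
    have h2 : ((starRingEnd ℂ) a * (a - w)).re = 1 - (a.re * w.re + a.im * w.im) := by
      simp; linarith
    rw [← h2]
    refine (Complex.re_le_norm _).trans ?_
    rw [norm_mul, RCLike.norm_conj, ha, one_mul, ← dist_eq_norm, dist_comm]
    exact hwa
  have h3 : Real.exp (N * (1 - (a.re * w.re + a.im * w.im))) *
      Real.exp (N * (a.re * w.re + a.im * w.im - 1)) = 1 := by
    rw [← Real.exp_add, ← Real.exp_zero]; congr 1; ring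
  calc ‖g w‖ = Real.exp (N * (1 - (a.re * w.re + a.im * w.im))) *
        (Real.exp (N * (a.re * w.re + a.im * w.im - 1)) * ‖g w‖) := by
          rw [← mul_assoc, h3, one_mul]
    _ ≤ _ := by gcongr

/-- Take `ε = 0` in the two-constants estimate and let `N` tend to infinity. -/
theorem eq_zero_near_arc {g : ℂ → ℂ} {a : ℂ} {r : ℝ} (ha : ‖a‖ = 1)
    (hr : 0 < r) (hr1 : r ≤ 1) (hd : DifferentiableOn ℂ g (ball 0 1 ∩ ball a r))
    (hc : ContinuousOn g (closedBall 0 1 ∩ closedBall a r))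
    (h0 : ∀ w ∈ sphere (0 : ℂ) 1 ∩ closedBall a r, g w = 0)
    {w : ℂ} (hw : ‖w‖ ≤ 1) (hwa : dist w a ≤ r ^ 2 / 4) : g w = 0 := by
  obtain ⟨M, hM⟩ := ((isCompact_closedBall (0 : ℂ) 1).inter
    (isCompact_closedBall a r)).exists_bound_of_continuousOn hc
  have hM0 : 0 ≤ M := (norm_nonneg _).trans (hM a ⟨by simp [ha], by simp [hr.le]⟩)
  have hb : ∀ N : ℕ, ‖g w‖ ≤ M * Real.exp (-(N * (r ^ 2 / 4))) := by
    intro N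
    have := two_constants_near_arc (N := N) (ε := 0) N.cast_nonneg ha hr hr1 hd hc hM
      (fun w hw => by simp [h0 w hw]) hw hwa
    rw [max_eq_right (by positivity), mul_left_comm, ← Real.exp_add] at this
    refine this.trans_eq ?_
    congr 2; ring
  have hlim : Tendsto (fun N : ℕ => M * Real.exp (-(N * (r ^ 2 / 4)))) atTop (𝓝 (M * 0)) := by
    refine Tendsto.const_mul _ (Real.tendsto_exp_neg_atTop_nhds_zero.comp ?_)
    exact tendsto_natCast_atTop_atTop.atTop_mul_const (by positivity)
  rw [mul_zero] at hlim
  exact norm_le_zero_iff.1 (ge_of_tendsto' hlim hb)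

/-- These boundary values vanish on one side of `b` and not on the other. Vanishing on an arc forces
`g` to vanish near a point of it, hence on the whole half-neighbourhood by the identity theorem, and
by continuity on the other arc too. -/
theorem not_boundary_values_max_im {g : ℂ → ℂ} {b : ℂ} {r : ℝ} (hb : ‖b‖ = 1)
    (hr : 0 < r) (hr1 : r ≤ 1) (hd : DifferentiableOn ℂ g (ball 0 1 ∩ ball b r))
    (hc : ContinuousOn g (closedBall 0 1 ∩ closedBall b r)) :
    ¬ ∀ w ∈ sphere (0 : ℂ) 1 ∩ closedBall b r,
      g w = ((max 0 ((starRingEnd ℂ) b * w).im : ℝ) : ℂ) := by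
  intro hg
  have hbb : (starRingEnd ℂ) b * b = 1 := by
    rw [mul_comm, Complex.mul_conj, Complex.normSq_eq_norm_sq, hb]; simp
  have hsin : 0 < Real.sin (r / 2) :=
    Real.sin_pos_of_pos_of_lt_pi (by positivity) (by linarith [Real.pi_gt_three])
  have hpt : ∀ t : ℝ, ‖b * Complex.exp (Complex.I * t)‖ = 1 ∧
      dist (b * Complex.exp (Complex.I * t)) b ≤ |t| ∧
      ((starRingEnd ℂ) b * (b * Complex.exp (Complex.I * t))).im = Real.sin t := by
    intro t
    refine ⟨?_, ?_, ?_⟩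
    · rw [norm_mul, hb, mul_comm Complex.I, Complex.norm_exp_ofReal_mul_I, one_mul]
    · have : b * Complex.exp (Complex.I * t) - b = b * (Complex.exp (Complex.I * t) - 1) := by ring
      rw [dist_eq_norm, this, norm_mul, hb, one_mul]
      exact Real.norm_exp_I_mul_ofReal_sub_one_le
    · rw [← mul_assoc, hbb, one_mul, mul_comm, Complex.exp_ofReal_mul_I_im]
  obtain ⟨ha1, ha1b, ha1i⟩ := hpt (-(r / 2))
  set a := b * Complex.exp (Complex.I * ((-(r / 2) : ℝ) : ℂ))
  rw [abs_neg, abs_of_pos (by positivity)] at ha1b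
  rw [Real.sin_neg] at ha1i
  -- Small enough that the closed ball of radius `s` about `a` stays inside that of radius `r` about
  -- `b` and in the half-plane `Im (conj b * w) ≤ 0`.
  set s := min (r / 2) (Real.sin (r / 2))
  have hs : 0 < s := lt_min (by positivity) hsin
  have hsr : s ≤ r / 2 := min_le_left _ _
  have hsub : closedBall a s ⊆ closedBall b r :=
    closedBall_subset_closedBall' (by linarith)
  have hsubo : ball a s ⊆ ball b r := ball_subset_ball' (by linarith)
  have hzero : ∀ w : ℂ, ‖w‖ ≤ 1 → dist w a ≤ s ^ 2 / 4 → g w = 0 := by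
    intro w hw hwa
    refine eq_zero_near_arc ha1 hs (by linarith) (hd.mono (inter_subset_inter_right _ hsubo))
      (hc.mono (inter_subset_inter_right _ hsub)) (fun w hw => ?_) hw hwa
    rw [hg w ⟨hw.1, hsub hw.2⟩, max_eq_left, Complex.ofReal_zero]
    have h1 : ((starRingEnd ℂ) b * (w - a)).im ≤ s := by
      refine (Complex.im_le_norm _).trans ?_
      rw [norm_mul, RCLike.norm_conj, hb, one_mul, ← dist_eq_norm]
      exact hw.2
    rw [mul_sub, Complex.sub_im, ha1i] at h1
    linarith [min_le_right (r / 2) (Real.sin (r / 2))]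
  set V : Set ℂ := ball 0 1 ∩ ball b r
  have hVo : IsOpen V := isOpen_ball.inter isOpen_ball
  have hclos : ∀ w : ℂ, ‖w‖ = 1 → dist w b < r → w ∈ closure V := by
    intro w hw hwb
    have := isOpen_ball.inter_closure (s := ball b r) (t := ball (0 : ℂ) 1)
      ⟨hwb, by rw [closure_ball _ one_ne_zero]; simp [hw]⟩
    rwa [inter_comm] at this
  obtain ⟨z, hz, hza⟩ := Metric.mem_closure_iff.1 (hclos a ha1 (by linarith)) (s ^ 2 / 4)
    (by positivity)
  have hVzero : EqOn g 0 V := by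
    refine (hd.analyticOnNhd hVo).eqOn_zero_of_preconnected_of_eventuallyEq_zero
      ((convex_ball _ _).inter (convex_ball _ _)).isPreconnected hz ?_
    rw [dist_comm] at hza
    filter_upwards [hVo.mem_nhds hz, isOpen_ball.mem_nhds (show z ∈ ball a (s ^ 2 / 4) from hza)]
      with w hw1 hw2
    exact hzero w (by simpa using (ball_subset_closedBall hw1.1)) (le_of_lt hw2)
  obtain ⟨hp1, hpb, hpi⟩ := hpt (r / 2)
  set p := b * Complex.exp (Complex.I * ((r / 2 : ℝ) : ℂ))
  rw [abs_of_pos (by positivity)] at hpb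
  have hpK : p ∈ closedBall (0 : ℂ) 1 ∩ closedBall b r :=
    ⟨by simp [hp1], by simp only [mem_closedBall]; linarith⟩
  have hpz : g p = 0 := by
    have : (𝓝[V] p).NeBot := mem_closure_iff_nhdsWithin_neBot.1 (hclos p hp1 (by linarith))
    have h1 : Tendsto g (𝓝[V] p) (𝓝 (g p)) := (hc p hpK).mono_left
      (nhdsWithin_mono _ (inter_subset_inter ball_subset_closedBall ball_subset_closedBall))
    have h2 : Tendsto g (𝓝[V] p) (𝓝 0) :=
      tendsto_const_nhds.congr' (by filter_upwards [self_mem_nhdsWithin] with w hw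
                                    exact (hVzero hw).symm)
    exact tendsto_nhds_unique h1 h2
  rw [hg p ⟨by simp [hp1], hpK.2⟩, hpi, max_eq_right hsin.le, Complex.ofReal_eq_zero] at hpz
  exact hsin.ne' hpz

end OneVariable

/-! ### Uniform limits of holomorphic functions -/

/-- A Cauchy estimate on balls of radius `s / 2` makes the derivatives uniformly Cauchy near each
point, so the limit is differentiable there. -/
theorem differentiableOn_of_tendstoUniformlyOn_complex {E : Type*} [NormedAddCommGroup E]
    [NormedSpace ℂ E] {F : ℕ → E → ℂ} {G : E → ℂ} {W : Set E} (hW : IsOpen W)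
    (hF : ∀ j, DifferentiableOn ℂ (F j) W) (h : TendstoUniformlyOn F G atTop W) :
    DifferentiableOn ℂ G W := by
  intro x hx
  obtain ⟨s, hs, hsW⟩ := Metric.isOpen_iff.1 hW x hx
  have hbW : ∀ y ∈ ball x (s / 2), ball y (s / 2) ⊆ W := fun y hy =>
    (ball_subset_ball' (by linarith [mem_ball.1 hy])).trans hsW
  have hyW : ∀ y ∈ ball x (s / 2), y ∈ W := fun y hy => hbW y hy (mem_ball_self (by positivity))
  have hdiff : ∀ j, ∀ y ∈ ball x (s / 2), DifferentiableAt ℂ (F j) y := fun j y hy =>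
    (hF j y (hyW y hy)).differentiableAt (hW.mem_nhds (hyW y hy))
  have hcau : UniformCauchySeqOn (fun j => fderiv ℂ (F j)) atTop (ball x (s / 2)) := by
    rw [Metric.uniformCauchySeqOn_iff]
    intro ε hε
    obtain ⟨N, hN⟩ := Metric.uniformCauchySeqOn_iff.1 h.uniformCauchySeqOn (ε * s / 8)
      (by positivity)
    refine ⟨N, fun m hm k hk y hy => ?_⟩
    have hb := Complex.norm_fderiv_le_div_of_mapsTo_ball (f := F m - F k) (c := y)
      (R₁ := s / 2) (R₂ := ε * s / 4) (((hF m).sub (hF k)).mono (hbW y hy)) ?_ (by positivity)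
    · rw [dist_eq_norm, ← fderiv_sub (hdiff m y hy) (hdiff k y hy)]
      refine hb.trans_lt ?_
      rw [div_lt_iff₀ (by positivity)]
      nlinarith [mul_pos hε hs]
    · intro z hz
      have h1 := hN m hm k hk z (hbW y hy hz)
      have h2 := hN m hm k hk y (hyW y hy)
      rw [dist_eq_norm] at h1 h2
      rw [mem_closedBall, dist_eq_norm]
      refine (norm_sub_le _ _).trans ?_
      simp only [Pi.sub_apply]
      linarith
  have hlim : ∀ y, ∃ L, y ∈ ball x (s / 2) → Tendsto (fun j => fderiv ℂ (F j) y) atTop (𝓝 L) := by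
    intro y
    by_cases hy : y ∈ ball x (s / 2)
    · obtain ⟨L, hL⟩ := cauchySeq_tendsto_of_complete (hcau.cauchySeq hy)
      exact ⟨L, fun _ => hL⟩
    · exact ⟨0, fun h => absurd h hy⟩
  choose L hL using hlim
  have hxb : x ∈ ball x (s / 2) := mem_ball_self (by positivity)
  refine (hasFDerivAt_of_tendstoUniformlyOn isOpen_ball
    (hcau.tendstoUniformlyOn_of_tendsto hL) (fun j y hy => (hdiff j y hy).hasFDerivAt)
    (fun y hy => h.tendsto_at (hyW y hy)) hxb).differentiableAt.differentiableWithinAt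

/-! ### The polydisc, its boundary and coordinate slices -/

section Polydisc

variable {n : ℕ}

theorem polydisc_eq_pi : polydisc n = Set.pi univ fun _ => ball (0 : ℂ) 1 := by
  ext z; simp [polydisc]

theorem isOpen_polydisc : IsOpen (polydisc n) := by
  rw [polydisc_eq_pi]; exact isOpen_set_pi finite_univ fun _ _ => isOpen_ball

theorem mem_polydiscBoundary {z : Fin n → ℂ} :
    z ∈ polydiscBoundary n ↔ (∀ i, ‖z i‖ ≤ 1) ∧ ∃ i, ‖z i‖ = 1 := by
  rw [polydiscBoundary, isOpen_polydisc.frontier_eq, polydisc_eq_pi, closure_pi_set]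
  simp only [closure_ball (0 : ℂ) one_ne_zero, Set.mem_sdiff, Set.mem_pi, mem_univ, true_imp_iff,
    mem_closedBall, mem_ball, dist_zero_right, not_forall, not_lt]
  exact ⟨fun ⟨h, i, hi⟩ => ⟨h, i, (h i).antisymm hi⟩, fun ⟨h, i, hi⟩ => ⟨h, i, hi.ge⟩⟩

theorem norm_apply_le_one_of_mem_oneSidedDomain {U : Set (Fin n → ℂ)} {z : Fin n → ℂ}
    (hz : z ∈ oneSidedDomain U) (i : Fin n) : ‖z i‖ ≤ 1 :=
  hz.elim (fun h => (h.2 i).le) fun h => (mem_polydiscBoundary.1 h).1 i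

theorem oneSidedDomain_mono {U V : Set (Fin n → ℂ)} (h : U ⊆ V) :
    oneSidedDomain U ⊆ oneSidedDomain V :=
  union_subset_union_left _ (inter_subset_inter_left _ h)

theorem IsOneSidedExtension.mono {f : polydiscBoundary n → ℂ} {U V : Set (Fin n → ℂ)}
    {F : (Fin n → ℂ) → ℂ} (hF : IsOneSidedExtension f V F) (h : U ⊆ V) :
    IsOneSidedExtension f U F :=
  ⟨hF.1.mono (inter_subset_inter_left _ h), hF.2⟩

theorem SeparatelyContinuousOn.mono {S T : Set (Fin n → ℂ)} {F : (Fin n → ℂ) → ℂ}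
    (hF : SeparatelyContinuousOn F T) (h : S ⊆ T) : SeparatelyContinuousOn F S :=
  fun z i => (hF z i).mono fun _ hw => h hw

theorem ContinuousOn.separatelyContinuousOn {S : Set (Fin n → ℂ)} {F : (Fin n → ℂ) → ℂ}
    (hF : ContinuousOn F S) : SeparatelyContinuousOn F S := fun z i =>
  hF.comp (f := fun w => Function.update z i w)
    (continuous_const (y := z).update i (continuous_id (X := ℂ))).continuousOn fun _ hw => hw

theorem isCompact_polydiscBoundary : IsCompact (polydiscBoundary n) := by
  refine Metric.isCompact_of_isClosed_isBounded isClosed_frontier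
    ((isBounded_closedBall (x := (0 : Fin n → ℂ)) (r := 1)).subset fun z hz => ?_)
  rw [mem_closedBall, dist_zero_right, pi_norm_le_iff_of_nonneg zero_le_one]
  exact (mem_polydiscBoundary.1 hz).1

instance : CompactSpace (polydiscBoundary n) :=
  isCompact_iff_compactSpace.1 isCompact_polydiscBoundary

theorem dist_update_lt {c z : Fin n → ℂ} {i : Fin n} {R : ℝ} (hz : dist z c < R) {w : ℂ}
    (hw : dist w (c i) < R) : dist (Function.update z i w) c < R := by
  rw [dist_pi_lt_iff (dist_nonneg.trans_lt hz)]
  intro k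
  rcases eq_or_ne k i with rfl | hk
  · simpa
  · rw [Function.update_of_ne hk]
    exact (dist_le_pi_dist z c k).trans_lt hz

section Slice

variable {c z : Fin n → ℂ} {i : Fin n} {R r : ℝ} {w : ℂ}

theorem update_mem_polydiscBoundary (hz : ∀ k, k ≠ i → ‖z k‖ < 1) (hw : ‖w‖ = 1) :
    Function.update z i w ∈ polydiscBoundary n := by
  refine mem_polydiscBoundary.2 ⟨fun k => ?_, i, by simpa⟩
  rcases eq_or_ne k i with rfl | hk
  · simpa using hw.le
  · rw [Function.update_of_ne hk]; exact (hz k hk).le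

theorem update_mem_polydisc (hz : ∀ k, k ≠ i → ‖z k‖ < 1) (hw : ‖w‖ < 1) :
    Function.update z i w ∈ polydisc n := by
  intro k
  rcases eq_or_ne k i with rfl | hk
  · simpa using hw
  · rw [Function.update_of_ne hk]; exact hz k hk

theorem update_mem_oneSidedDomain (hz : ∀ k, k ≠ i → ‖z k‖ < 1) (hzc : dist z c < R)
    (hrR : r < R) (hw : w ∈ closedBall (0 : ℂ) 1 ∩ closedBall (c i) r) :
    Function.update z i w ∈ oneSidedDomain (ball c R) := by
  have hw1 : ‖w‖ ≤ 1 := by simpa using hw.1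
  rcases hw1.lt_or_eq with h | h
  · exact Or.inl ⟨dist_update_lt hzc ((mem_closedBall.1 hw.2).trans_lt hrR),
      update_mem_polydisc hz h⟩
  · exact Or.inr (update_mem_polydiscBoundary hz h)

theorem continuousOn_slice {F : (Fin n → ℂ) → ℂ} (hz : ∀ k, k ≠ i → ‖z k‖ < 1)
    (hzc : dist z c < R) (hrR : r < R)
    (hF : SeparatelyContinuousOn F (oneSidedDomain (ball c R))) :
    ContinuousOn (fun w => F (Function.update z i w)) (closedBall 0 1 ∩ closedBall (c i) r) :=
  (hF z i).mono fun _ hw => update_mem_oneSidedDomain hz hzc hrR hw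

theorem differentiableOn_slice {F : (Fin n → ℂ) → ℂ} (hz : ∀ k, k ≠ i → ‖z k‖ < 1)
    (hzc : dist z c < R) (hrR : r < R)
    (hF : DifferentiableOn ℂ F (ball c R ∩ polydisc n)) :
    DifferentiableOn ℂ (fun w => F (Function.update z i w)) (ball 0 1 ∩ ball (c i) r) := by
  refine hF.comp (f := fun w => Function.update z i w) (fun w _ => ?_) fun w hw => ⟨?_, ?_⟩
  · exact (hasFDerivAt_update z w).differentiableAt.differentiableWithinAt
  · exact dist_update_lt hzc ((mem_ball.1 hw.2).trans hrR)
  · exact update_mem_polydisc hz (by simpa using hw.1)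

end Slice

/-! ### Closures of sets of boundedly extendable functions -/

/-- For interior `z`, apply the two-constants estimate to the slice through `z` in a coordinate `i`
with `‖c i‖ = 1`: the other coordinates of `z` lie in the open disc, so the unit circle of the slice
lies in `∂Dⁿ`. -/
theorem norm_extension_le {F : (Fin n → ℂ) → ℂ} {c : Fin n → ℂ} (hc : c ∈ polydiscBoundary n)
    {R r M ε N : ℝ} (hr : 0 < r) (hr1 : r ≤ 1) (hrR : r < R) (hN : 0 ≤ N)
    (hd : DifferentiableOn ℂ F (ball c R ∩ polydisc n))
    (hs : SeparatelyContinuousOn F (oneSidedDomain (ball c R)))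
    (hM : ∀ z ∈ oneSidedDomain (ball c R), ‖F z‖ ≤ M)
    (hε : ∀ z ∈ polydiscBoundary n, ‖F z‖ ≤ ε)
    {z : Fin n → ℂ} (hz : z ∈ oneSidedDomain (ball c (r ^ 2 / 4))) :
    ‖F z‖ ≤ Real.exp (N * (r ^ 2 / 4)) * max ε (M * Real.exp (-(N * (r ^ 2 / 2)))) := by
  rcases hz with hz | hz
  · obtain ⟨i, hi⟩ := (mem_polydiscBoundary.1 hc).2
    have hz1 : ∀ k, k ≠ i → ‖z k‖ < 1 := fun k _ => hz.2 k
    have hzc : dist z c < R := (mem_ball.1 hz.1).trans (by nlinarith)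
    have := two_constants_near_arc hN hi hr hr1 (differentiableOn_slice hz1 hzc hrR hd)
      (continuousOn_slice hz1 hzc hrR hs)
      (fun w hw => hM _ (update_mem_oneSidedDomain hz1 hzc hrR hw))
      (fun w hw => hε _ (update_mem_polydiscBoundary hz1 (by simpa using hw.1)))
      (w := z i) (hz.2 i).le ((dist_le_pi_dist z c i).trans (mem_ball.1 hz.1).le)
    simpa using this
  · have h0 : 0 ≤ ε := (norm_nonneg _).trans (hε z hz)
    refine (hε z hz).trans ((le_max_left ε (M * Real.exp (-(N * (r ^ 2 / 2))))).trans ?_)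
    exact le_mul_of_one_le_left (h0.trans (le_max_left _ _)) (Real.one_le_exp (by positivity))

/-- The functions having an extension to `ball c R` that is bounded by `M`, separately continuous
and satisfies `P`. -/
def boundedExtendable (P : ((Fin n → ℂ) → ℂ) → Prop) (c : Fin n → ℂ) (R M : ℝ) :
    Set C(polydiscBoundary n, ℂ) :=
  {f | ∃ F : (Fin n → ℂ) → ℂ, IsOneSidedExtension f (ball c R) F ∧
    (∀ z ∈ oneSidedDomain (ball c R), ‖F z‖ ≤ M) ∧
    SeparatelyContinuousOn F (oneSidedDomain (ball c R)) ∧ P F}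

/-- Differences of the approximating extensions are bounded by `2 * M` and small on `∂Dⁿ`, hence
uniformly small near `c`. The approximants `Φ` are returned so that a closed condition such as a
Lipschitz bound can be passed to the limit. -/
theorem exists_limit_extension {P : ((Fin n → ℂ) → ℂ) → Prop} {c : Fin n → ℂ}
    (hc : c ∈ polydiscBoundary n) {R M : ℝ} (hR : 0 < R) {f : C(polydiscBoundary n, ℂ)}
    (hf : f ∈ closure (boundedExtendable P c R M)) :
    ∃ ρ > 0, ρ ≤ R ∧ ∃ F : (Fin n → ℂ) → ℂ, IsOneSidedExtension f (ball c ρ) F ∧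
      (∀ z ∈ oneSidedDomain (ball c ρ), ‖F z‖ ≤ M) ∧
      SeparatelyContinuousOn F (oneSidedDomain (ball c ρ)) ∧
      ∃ Φ : ℕ → (Fin n → ℂ) → ℂ, (∀ j, P (Φ j)) ∧
        TendstoUniformlyOn Φ F atTop (oneSidedDomain (ball c ρ)) := by
  obtain ⟨u, hu, hlim⟩ := mem_closure_iff_seq_limit.1 hf
  choose Φ hext hM hsep hP using hu
  set r := min (R / 2) 1
  have hr : 0 < r := lt_min (by positivity) one_pos
  have hr1 : r ≤ 1 := min_le_right _ _
  have hrR : r < R := (min_le_left _ _).trans_lt (by linarith)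
  have hρR : r ^ 2 / 4 ≤ R := by nlinarith
  have hsub : ball c (r ^ 2 / 4) ⊆ ball c R := ball_subset_ball hρR
  have hdom := oneSidedDomain_mono hsub
  have hM0 : 0 ≤ M := (norm_nonneg _).trans (hM 0 c (Or.inr hc))
  have hcau : UniformCauchySeqOn Φ atTop (oneSidedDomain (ball c (r ^ 2 / 4))) := by
    rw [Metric.uniformCauchySeqOn_iff]
    intro ε hε
    have hexp : Tendsto (fun N : ℕ => 2 * M * Real.exp (-(N * (r ^ 2 / 4)))) atTop
        (𝓝 (2 * M * 0)) := by
      refine Tendsto.const_mul _ (Real.tendsto_exp_neg_atTop_nhds_zero.comp ?_)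
      exact tendsto_natCast_atTop_atTop.atTop_mul_const (by positivity)
    rw [mul_zero] at hexp
    -- `N` is fixed first to make the interior term less than `ε`; `δ` then absorbs the factor `exp
    -- (N r² / 4)` in the boundary term.
    obtain ⟨N, hN⟩ := (hexp.eventually_lt_const hε).exists
    set δ := ε / 2 * Real.exp (-(N * (r ^ 2 / 4)))
    have hδ : 0 < δ := by positivity
    obtain ⟨J, hJ⟩ := Metric.cauchySeq_iff.1 hlim.cauchySeq δ hδ
    refine ⟨J, fun m hm k hk z hz => ?_⟩
    have hb := norm_extension_le (F := fun z => Φ m z - Φ k z) (M := 2 * M) (ε := δ) hc hr hr1 hrR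
      N.cast_nonneg ((hext m).1.sub (hext k).1)
      (fun z i => ((hsep m) z i).sub ((hsep k) z i))
      (fun z hz => (norm_sub_le _ _).trans (by linarith [hM m z hz, hM k z hz]))
      (fun z hz => by
        have h1 := (hext m).2 ⟨z, hz⟩
        have h2 := (hext k).2 ⟨z, hz⟩
        simp only at h1 h2
        rw [h1, h2, ← dist_eq_norm]
        exact (ContinuousMap.dist_apply_le_dist _).trans (hJ m hm k hk).le) hz
    rw [dist_eq_norm]
    refine hb.trans_lt ?_
    rw [mul_max_of_nonneg _ _ (Real.exp_pos _).le, max_lt_iff]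
    constructor
    · have : Real.exp (N * (r ^ 2 / 4)) * δ = ε / 2 := by
        rw [mul_left_comm, ← Real.exp_add, add_neg_cancel, Real.exp_zero, mul_one]
      linarith
    · rw [mul_left_comm, ← Real.exp_add]
      convert hN using 3
      ring
  have hex : ∀ z, ∃ L, z ∈ oneSidedDomain (ball c (r ^ 2 / 4)) →
      Tendsto (fun j => Φ j z) atTop (𝓝 L) := by
    intro z
    by_cases hz : z ∈ oneSidedDomain (ball c (r ^ 2 / 4))
    · obtain ⟨L, hL⟩ := cauchySeq_tendsto_of_complete (hcau.cauchySeq hz)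
      exact ⟨L, fun _ => hL⟩
    · exact ⟨0, fun h => absurd h hz⟩
  choose F hF using hex
  have hunif := hcau.tendstoUniformlyOn_of_tendsto hF
  refine ⟨r ^ 2 / 4, by positivity, hρR, F, ⟨?_, fun z => ?_⟩, fun z hz => ?_, fun z i => ?_,
    Φ, hP, hunif⟩
  · exact differentiableOn_of_tendstoUniformlyOn_complex (isOpen_ball.inter isOpen_polydisc)
      (fun j => (hext j).1.mono (inter_subset_inter_left _ hsub))
      (hunif.mono subset_union_left)
  · refine tendsto_nhds_unique (hF z (Or.inr z.2)) ?_
    simp only [fun j => (hext j).2 z]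
    exact ((ContinuousEvalConst.continuous_eval_const z).tendsto f).comp hlim
  · exact le_of_tendsto' (hF z hz).norm fun j => hM j z (hdom hz)
  · refine TendstoUniformlyOn.continuousOn (F := fun j w => Φ j (Function.update z i w))
      (p := atTop) ?_ (Frequently.of_forall fun j => ((hsep j).mono hdom) z i)
    exact hunif.comp fun w => Function.update z i w

/-! ### Extendability at a point defines a proper subspace -/

/-- The space of functions extendable at `c` in the separately continuous sense. -/
def sepContExtendableSubmodule (c : polydiscBoundary n) :
    Submodule ℂ C(polydiscBoundary n, ℂ) where
  carrier := {f | SepContOneSidedExtendableAt f c}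
  zero_mem' := ⟨univ, isOpen_univ, mem_univ _, 0, ⟨differentiableOn_const 0, fun _ => rfl⟩,
    ⟨0, by simp⟩, fun _ _ => continuousOn_const⟩
  add_mem' := by
    rintro f g ⟨U, hU, hcU, F, hF, ⟨M, hM⟩, hFs⟩ ⟨V, hV, hcV, G, hG, ⟨K, hK⟩, hGs⟩
    have hl : U ∩ V ⊆ U := inter_subset_left
    have hr : U ∩ V ⊆ V := inter_subset_right
    refine ⟨U ∩ V, hU.inter hV, ⟨hcU, hcV⟩, F + G,
      ⟨(hF.mono hl).1.add (hG.mono hr).1, fun z => ?_⟩, ⟨M + K, fun z hz => ?_⟩, fun z i => ?_⟩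
    · simp [hF.2 z, hG.2 z]
    · exact (norm_add_le _ _).trans (add_le_add (hM z (oneSidedDomain_mono hl hz))
        (hK z (oneSidedDomain_mono hr hz)))
    · exact (hFs.mono (oneSidedDomain_mono hl) z i).add (hGs.mono (oneSidedDomain_mono hr) z i)
  smul_mem' := by
    rintro a f ⟨U, hU, hcU, F, hF, ⟨M, hM⟩, hFs⟩
    refine ⟨U, hU, hcU, a • F, ⟨hF.1.const_smul a, fun z => ?_⟩, ⟨‖a‖ * M, fun z hz => ?_⟩,
      fun z i => (hFs z i).const_smul a⟩
    · simp [hF.2 z]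
    · rw [Pi.smul_apply, norm_smul]
      exact mul_le_mul_of_nonneg_left (hM z hz) (norm_nonneg a)

theorem exists_not_sepContOneSidedExtendableAt (c : polydiscBoundary n) :
    ∃ f : C(polydiscBoundary n, ℂ), ¬ SepContOneSidedExtendableAt f c := by
  obtain ⟨hc1, i, hi⟩ := mem_polydiscBoundary.1 c.2
  refine ⟨⟨fun z => ((max 0 ((starRingEnd ℂ) (c.1 i) * z.1 i).im : ℝ) : ℂ), 
    Complex.continuous_ofReal.comp (continuous_const.max (Complex.continuous_im.comp
      (continuous_const.mul ((continuous_apply i).comp continuous_subtype_val))))⟩, ?_⟩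
  rintro ⟨U, hU, hcU, F, hF, -, hFs⟩
  obtain ⟨R, hR, hRU⟩ := Metric.isOpen_iff.1 hU _ hcU
  set r := min (R / 2) 1
  have hr : 0 < r := lt_min (by positivity) one_pos
  have hr1 : r ≤ 1 := min_le_right _ _
  have hrR : r < R := (min_le_left _ _).trans_lt (by linarith)
  -- A point of the open polydisc near `c` replaces `c`, so that the slice in coordinate `i` has its
  -- unit circle in `∂Dⁿ` and its open disc in `Dⁿ`.
  obtain ⟨z, hz, hzc⟩ := Metric.mem_closure_iff.1 (frontier_subset_closure c.2) R hR
  rw [dist_comm] at hzc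
  have hz1 : ∀ k, k ≠ i → ‖z k‖ < 1 := fun k _ => hz k
  refine not_boundary_values_max_im hi hr hr1
    (differentiableOn_slice hz1 hzc hrR (hF.mono hRU).1)
    (continuousOn_slice hz1 hzc hrR (hFs.mono (oneSidedDomain_mono hRU))) fun w hw => ?_
  have := hF.2 ⟨_, update_mem_polydiscBoundary hz1 (w := w) (by simpa using hw.1)⟩
  simpa using this

theorem interior_sepContExtendable_eq_empty (c : polydiscBoundary n) :
    interior {f : C(polydiscBoundary n, ℂ) | SepContOneSidedExtendableAt f c} = ∅ := by
  by_contra h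
  have htop := (sepContExtendableSubmodule c).eq_top_of_nonempty_interior'
    (nonempty_iff_ne_empty.2 h)
  obtain ⟨f, hf⟩ := exists_not_sepContOneSidedExtendableAt c
  exact hf (show f ∈ sepContExtendableSubmodule c by rw [htop]; trivial)

/-! ### The Baire category argument and the three notions of extendability -/

/-- `hout` moves an extension at `ζ` to a nearby centre with integer bounds; `hin` says that passing
to closures creates no non-extendable function. Together they exhibit the extendable functions as a
countable union of closed sets, each with empty interior by `hsep`. -/
theorem isGδ_dense_setOf_forall_not {Ext : C(polydiscBoundary n, ℂ) → polydiscBoundary n → Prop}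
    {P : ℕ → (Fin n → ℂ) → ℝ → ((Fin n → ℂ) → ℂ) → Prop}
    (hsep : ∀ f ζ, Ext f ζ → SepContOneSidedExtendableAt f ζ)
    (hout : ∀ f ζ, Ext f ζ → ∃ R > 0, ∀ c : polydiscBoundary n, ∀ ρ ≤ R, dist (c : Fin n → ℂ) ζ < R →
      ∃ N : ℕ, f ∈ boundedExtendable (P N c ρ) c ρ N)
    (hin : ∀ (f) (c : polydiscBoundary n) (R : ℝ) (N : ℕ), 0 < R →
      f ∈ closure (boundedExtendable (P N c R) c R N) → Ext f c) :
    IsGδ {f | ∀ ζ, ¬ Ext f ζ} ∧ Dense {f | ∀ ζ, ¬ Ext f ζ} := by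
  obtain ⟨s, hsc, hsd⟩ := TopologicalSpace.exists_countable_dense (polydiscBoundary n)
  have := hsc.to_subtype
  set T : s × ℕ × ℕ → Set C(polydiscBoundary n, ℂ) := fun p =>
    closure (boundedExtendable (P p.2.1 p.1.1 (1 / (p.2.2 + 1))) p.1.1 (1 / (p.2.2 + 1)) p.2.1)
  have hT : ∀ p, ∀ f ∈ T p, Ext f p.1.1 := fun p f hf => hin f _ _ _ (by positivity) hf
  have heq : {f | ∀ ζ, ¬ Ext f ζ} = ⋂ p, (T p)ᶜ := by
    ext f
    simp only [mem_ofPred_eq, mem_iInter, mem_compl_iff]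
    refine ⟨fun h p hp => h _ (hT p f hp), fun h ζ hζ => ?_⟩
    obtain ⟨R, hR, hN⟩ := hout f ζ hζ
    obtain ⟨c, hcs, hcR⟩ := hsd.exists_dist_lt ζ hR
    obtain ⟨m, hm⟩ := exists_nat_one_div_lt hR
    obtain ⟨N, hN⟩ := hN c _ hm.le (by rw [dist_comm]; exact hcR)
    exact h (⟨c, hcs⟩, N, m) (subset_closure hN)
  have hopen : ∀ p, IsOpen (T p)ᶜ := fun p => isClosed_closure.isOpen_compl
  rw [heq]
  refine ⟨IsGδ.iInter_of_isOpen hopen, dense_iInter_of_isOpen hopen fun p => ?_⟩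
  rw [← interior_eq_empty_iff_dense_compl, ← subset_empty_iff,
    ← interior_sepContExtendable_eq_empty p.1.1]
  exact interior_mono fun f hf => hsep f _ (hT p f hf)

theorem isGδ_dense_nowhereSepContOneSidedExtendable :
    IsGδ (nowhereSepContOneSidedExtendable n) ∧ Dense (nowhereSepContOneSidedExtendable n) := by
  refine isGδ_dense_setOf_forall_not (P := fun _ _ _ _ => True)
    (Ext := fun f ζ => SepContOneSidedExtendableAt f ζ) (fun _ _ h => h) ?_ ?_
  · rintro f ζ ⟨U, hU, hζ, F, hF, ⟨M, hM⟩, hFs⟩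
    obtain ⟨R, hR, hRU⟩ := Metric.isOpen_iff.1 hU _ hζ
    refine ⟨R / 2, by positivity, fun c ρ hρ hc => ?_⟩
    obtain ⟨N, hN⟩ := exists_nat_ge M
    have hsub : ball (c : Fin n → ℂ) ρ ⊆ U := (ball_subset_ball' (by linarith)).trans hRU
    exact ⟨N, F, hF.mono hsub, fun z hz => (hM z (oneSidedDomain_mono hsub hz)).trans hN,
      hFs.mono (oneSidedDomain_mono hsub), trivial⟩
  · intro f c R N hR hf
    obtain ⟨ρ, hρ, -, F, hF, hM, hFs, -⟩ := exists_limit_extension c.2 hR hf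
    exact ⟨_, isOpen_ball, mem_ball_self hρ, F, hF, ⟨N, hM⟩, hFs⟩

theorem exists_bound_of_lipschitzOnWith_oneSidedDomain {F : (Fin n → ℂ) → ℂ} {K : NNReal}
    {U : Set (Fin n → ℂ)} (hF : LipschitzOnWith K F (oneSidedDomain U)) :
    ∃ M : ℝ, ∀ z ∈ oneSidedDomain U, ‖F z‖ ≤ M := by
  rcases (oneSidedDomain U).eq_empty_or_nonempty with h | ⟨y, hy⟩
  · simp [h]
  refine ⟨‖F y‖ + K * 2, fun z hz => ?_⟩
  -- The domain lies in the closed polydisc, of diameter at most 2 in the sup norm.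
  have hzy : dist z y ≤ 2 := (dist_pi_le_iff zero_le_two).2 fun i => by
    rw [dist_eq_norm]
    refine (norm_sub_le _ _).trans ?_
    linarith [norm_apply_le_one_of_mem_oneSidedDomain hz i,
      norm_apply_le_one_of_mem_oneSidedDomain hy i]
  have h1 := hF.dist_le_mul z hz y hy
  have h2 : (K : ℝ) * dist z y ≤ K * 2 := mul_le_mul_of_nonneg_left hzy K.coe_nonneg
  rw [dist_eq_norm] at h1
  linarith [norm_le_norm_add_norm_sub' (F z) (F y)]

theorem LipschitzOneSidedExtendableAt.sepCont {f : polydiscBoundary n → ℂ}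
    {ζ : polydiscBoundary n} (h : LipschitzOneSidedExtendableAt f ζ) :
    SepContOneSidedExtendableAt f ζ := by
  obtain ⟨U, hU, hζ, F, hF, K, hK⟩ := h
  exact ⟨U, hU, hζ, F, hF, exists_bound_of_lipschitzOnWith_oneSidedDomain hK,
    hK.continuousOn.separatelyContinuousOn⟩

/-- Continuity at `ζ` bounds `F` on a smaller neighbourhood; on the rest of the domain, which is all
of `∂Dⁿ`, the bound is `‖f‖`. -/
theorem OneSidedExtendableAt.sepCont {f : C(polydiscBoundary n, ℂ)} {ζ : polydiscBoundary n}
    (h : OneSidedExtendableAt f ζ) : SepContOneSidedExtendableAt f ζ := by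
  obtain ⟨U, hU, hζ, F, hF, hFc⟩ := h
  have hbd : ∀ᶠ z in 𝓝[oneSidedDomain U] (ζ : Fin n → ℂ), ‖F z‖ < ‖F ζ‖ + 1 :=
    (hFc ζ (Or.inr ζ.2)).norm.eventually_lt_const (lt_add_one _)
  obtain ⟨V, hV, hζV, hVF⟩ := mem_nhdsWithin.1 hbd
  have hsub : U ∩ V ⊆ U := inter_subset_left
  refine ⟨U ∩ V, hU.inter hV, ⟨hζ, hζV⟩, F, hF.mono hsub,
    ⟨max (‖F ζ‖ + 1) ‖f‖, fun z hz => ?_⟩,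
    (hFc.mono (oneSidedDomain_mono hsub)).separatelyContinuousOn⟩
  rcases hz with hz | hz
  · exact le_max_of_le_left (le_of_lt (hVF ⟨hz.1.2, Or.inl ⟨hz.1.1, hz.2⟩⟩))
  · have := hF.2 ⟨z, hz⟩
    simp only at this
    rw [this]
    exact le_max_of_le_right (f.norm_coe_le_norm _)

theorem isGδ_dense_nowhereLipschitzOneSidedExtendable :
    IsGδ (nowhereLipschitzOneSidedExtendable n) ∧
      Dense (nowhereLipschitzOneSidedExtendable n) := by
  refine isGδ_dense_setOf_forall_not
    (P := fun N c R F => LipschitzOnWith N F (oneSidedDomain (ball c R)))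
    (Ext := fun f ζ => LipschitzOneSidedExtendableAt f ζ) (fun _ _ h => h.sepCont) ?_ ?_
  · rintro f ζ ⟨U, hU, hζ, F, hF, K, hK⟩
    obtain ⟨R, hR, hRU⟩ := Metric.isOpen_iff.1 hU _ hζ
    refine ⟨R / 2, by positivity, fun c ρ hρ hc => ?_⟩
    obtain ⟨M, hM⟩ := exists_bound_of_lipschitzOnWith_oneSidedDomain hK
    obtain ⟨N, hN⟩ := exists_nat_ge (max M K)
    have hsub : ball (c : Fin n → ℂ) ρ ⊆ U := (ball_subset_ball' (by linarith)).trans hRU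
    have hdom := oneSidedDomain_mono hsub
    refine ⟨N, F, hF.mono hsub, fun z hz => (hM z (hdom hz)).trans ((le_max_left _ _).trans hN),
      (hK.mono hdom).continuousOn.separatelyContinuousOn, (hK.mono hdom).weaken ?_⟩
    exact_mod_cast (le_max_right _ _).trans hN
  · intro f c R N hR hf
    obtain ⟨ρ, hρ, hρR, F, hF, -, -, Φ, hΦ, hlim⟩ := exists_limit_extension c.2 hR hf
    refine ⟨_, isOpen_ball, mem_ball_self hρ, F, hF, N, ?_⟩
    -- All approximants share the constant `N`, so the Lipschitz inequality survives the pointwise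
    -- limit.
    refine LipschitzOnWith.of_dist_le_mul fun x hx y hy => ?_
    have hdom := oneSidedDomain_mono (ball_subset_ball (x := (c : Fin n → ℂ)) hρR)
    exact le_of_tendsto' ((hlim.tendsto_at hx).dist (hlim.tendsto_at hy))
      fun j => (hΦ j).dist_le_mul x (hdom hx) y (hdom hy)

end Polydisc

theorem mainTheorem11 (n : ℕ) :
    (IsGδ (nowhereSepContOneSidedExtendable n) ∧ Dense (nowhereSepContOneSidedExtendable n)) ∧
    (∃ A : Set C(polydiscBoundary n, ℂ),
      A ⊆ nowhereOneSidedExtendable n ∧ IsGδ A ∧ Dense A) ∧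
    (IsGδ (nowhereLipschitzOneSidedExtendable n) ∧
      Dense (nowhereLipschitzOneSidedExtendable n)) :=
  ⟨isGδ_dense_nowhereSepContOneSidedExtendable,
    ⟨nowhereSepContOneSidedExtendable n, fun _ hf ζ h => hf ζ h.sepCont,
      isGδ_dense_nowhereSepContOneSidedExtendable⟩,
    isGδ_dense_nowhereLipschitzOneSidedExtendable⟩
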